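/- Let $p,q\in\mathbb{N}$ with $\gcd(p,q)=1$ and $q\ge 3$, and let $\lambda=e^{2\pi i p/q}$. Define $F_\lambda:\mathbb{C}\to\mathbb{C}$ by $F_\lambda(z)=\lambda\,(z-H(z))$, where $H(z)=1$ if $\operatorname{Im} z\ge 0$ and $H(z)=-1$ if $\operatorname{Im} z<0$. Let $$\mathcal{F}=\{z\in\mathbb{C} : \operatorname{Im}(F_\lambda^{i}(z))=0 \text{ for some integer } i\ge 0\}$$ be the critical set, $\overline{\mathcal{F}}$ its closure, and $\mathcal{U}=\mathbb{C}\setminus\overline{\mathcal{F}}$ the regular set. Then $\mathcal{U}$ and $\overline{\mathcal{F}}$ are both forward and backward invariant under $F_\lambda$, that is, $$F_\lambda(\mathcal{U})=\mathcal{U}=F_\lambda^{-1}(\mathcal{U}),\qquad F_\lambda(\overline{\mathcal{F}})=\overline{\mathcal{F}}=F_\lambda^{-1}(\overline{\mathcal{F}}).$$ Moreover, the restriction $F_\lambda|_{\mathcal{U}}:\mathcal{U}\to\mathcal{U}$ is a homeomorphism, it is pointwise periodic (for every $z\in\mathcal{U}$ there is an integer $n\ge 1$ with $F_\lambda^{n}(z)=z$),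 and it permutes the connected components of $\mathcal{U}$: the map $V\mapsto F_\lambda(V)$ is a bijection of the set of connected components of $\mathcal{U}$ onto itself. -/

import Mathlib

namespace PiecewiseRotation

/-- The sign function `H`: `1` on the closed upper half-plane, `-1` on the open lower one. -/
noncomputable def H (z : ℂ) : ℂ := if 0 ≤ z.im then 1 else -1

/-- The piecewise rotation `F_lam(z) = lam * (z - H z)`. -/
noncomputable def F (lam : ℂ) (z : ℂ) : ℂ := lam * (z - H z)

/-- The critical set: all points some iterate of which lies on the real line. -/
def criticalSet (lam : ℂ) : Set ℂ := {z | ∃ i : ℕ, ((F lam)^[i] z).im = 0}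

/-- The regular set: the complement of the closure of the critical set. -/
def regularSet (lam : ℂ) : Set ℂ := (closure (criticalSet lam))ᶜ

/-- The connected components of a subset `S` of the plane, as subsets of the plane. -/
def components (S : Set ℂ) : Set (Set ℂ) := {V | ∃ z ∈ S, V = connectedComponentIn S z}

end PiecewiseRotation

namespace PiecewiseRotation

open Finset

/-! Everything reduces to boundedness of the orbits that avoid the real line (`orbit_bounded`).
Write `lam` as the rotation by `a * π / N` with `a` prime to `N` (`exists_rot`). Surround a large
convex polygon by a necklace of regular `2N`-gons with horizontal sides, consecutive ones touching
at a vertex. No cell crosses the real axis, so `F` moves whole cells. It slides the upper and lower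
halves past each other by two units, which turns one link of the side before corner `0` into a link
of side `0`, and likewise at the opposite corner. If the side lengths satisfy `Balanced`, rotating
by `a` sectors restores the same necklace. Such necklaces exist with arbitrarily long sides
(`balanced_exists`), so every point is enclosed by one. A point of the polygon stays inside it or
already lies in a cell (`F_mem_polygon_or_cell`), so the region is invariant off the real line.

Near a regular point, each `F^n` is a rigid motion with linear part `lam ^ n` (`iterate_sub`). Along
multiples of `q` it is a translation. A bounded orbit returns close to its start, and by injectivity
some iterate then translates the point by a small vector. Repeating the translation would be
unbounded unless the vector is zero, so the point is periodic (`exists_periodic`). Periodicity gives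
backward invariance, and the remaining claims follow because `F` is a bijection of the plane,
continuous with continuous inverse on the regular set. -/

/-- The planar cross product, `Im (u * conj v)`. -/
def cross (u v : ℂ) : ℝ := u.im * v.re - u.re * v.im

/-- The angle between consecutive rays. -/
noncomputable def angle (N : ℕ) : ℝ := Real.pi / N

/-- The width of a cell. -/
noncomputable def width (N : ℕ) : ℝ := Real.cos (angle N / 2) / Real.sin (angle N / 2)

/-- The vector between the centres of neighbouring cells of the `k`-th sector. -/
noncomputable def stride (N k : ℕ) : ℂ :=
  ⟨-Real.sin ((k + 1 / 2) * angle N) / Real.sin (angle N / 2),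
    Real.cos ((k + 1 / 2) * angle N) / Real.sin (angle N / 2)⟩

/-- The rotation by `a` sectors. -/
noncomputable def rot (N a : ℕ) : ℂ := ⟨Real.cos (a * angle N), Real.sin (a * angle N)⟩

/-- The corners of a closed centrally symmetric polygon with `k`-th side `M k • stride N k`. -/
noncomputable def corner (N : ℕ) (M : ℕ → ℕ) (k : ℕ) : ℂ :=
  -(1 / 2) * ∑ i ∈ range N, (M (k + i) : ℂ) * stride N (k + i)

/-- The polygon with the given corners. -/
def polygon (N : ℕ) (M : ℕ → ℕ) : Set ℂ :=
  {z | ∀ k, 0 ≤ cross (z - corner N M k) (stride N k)}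

/-- The centres of the cells on the boundary of the polygon. -/
def centres (N : ℕ) (M : ℕ → ℕ) : Set ℂ :=
  {c | ∃ k j, j < M k ∧ c = corner N M k + j * stride N k}

/-- The regular `2N`-gon with unit sides centred at the origin. -/
def cell (N : ℕ) : Set ℂ :=
  {u | ∀ k : ℕ, |u.im * Real.cos (k * angle N) + u.re * Real.sin (k * angle N)| ≤ width N / 2}

/-- The polygon together with the necklace of cells along its boundary. -/
def necklaceRegion (N : ℕ) (M : ℕ → ℕ) : Set ℂ :=
  polygon N M ∪ {z | ∃ c ∈ centres N M, z - c ∈ cell N}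

/-- The combinatorial condition on the side lengths that makes the necklace invariant. -/
structure Balanced (N a : ℕ) (M : ℕ → ℕ) : Prop where
  pos : ∀ k, 1 ≤ M k
  periodic : ∀ k, M (k + N) = M k
  shift : ∀ k < N, M (k + a) + (if k = N - 1 then 1 else 0) = M k + (if k = 0 then 1 else 0)
  reflect : ∀ k < N,
    M (N - 1 - k) + (if k = N - 1 then 1 else 0) = M k + (if k = 0 then 1 else 0)

/-! ### Existence of balanced side lengths -/

/-- In the coordinate `v = k / a` modulo `N`, the shift by `a` becomes `v ↦ v + 1`. The length must
rise after `v = 0` and fall after the coordinate `r` of `N - 1`, so it is a constant plus the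
indicator of `1 ≤ v ≤ r`. The reflection `k ↦ N - 1 - k` becomes `v ↦ r - v`, which exchanges `0`
and `r` and preserves the rest of each level set. -/
lemma balanced_exists (N a m : ℕ) (hN : 2 ≤ N) (h : Nat.Coprime a N) :
    ∃ M, Balanced N a M ∧ ∀ k, m ≤ M k := by
  have : NeZero N := ⟨by omega⟩
  have : Fact (1 < N) := ⟨by omega⟩
  obtain ⟨b, hab⟩ : ∃ b : ZMod N, (a : ZMod N) * b = 1 :=
    ⟨_, ZMod.coe_mul_inv_eq_one a h⟩
  have hbinj : ∀ x y : ZMod N, x * b = y * b → x = y := fun x y e => by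
    have := congrArg (· * (a : ZMod N)) e
    simpa [mul_assoc, mul_comm b, hab] using this
  set r : ℕ := (-b).val with hr
  have hbne : b ≠ 0 := by rintro rfl; simp at hab
  have hr0 : r ≠ 0 := by rw [hr, Ne, ZMod.val_eq_zero]; simpa using hbne
  have hrN : r < N := ZMod.val_lt _
  have hrb : (r : ZMod N) = -b := by simp [hr]
  have key : ∀ k < N, ∀ v : ℕ, v = ((k : ZMod N) * b).val →
      v < N ∧ (v = 0 ↔ k = 0) ∧ (v = r ↔ k = N - 1) ∧ (v : ZMod N) = k * b := by
    rintro k hk v rfl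
    refine ⟨ZMod.val_lt _, ?_, ?_, by simp⟩
    · rw [ZMod.val_eq_zero]
      constructor
      · intro e
        have : (k : ZMod N) = 0 := hbinj _ _ (by simpa using e)
        rw [ZMod.natCast_eq_zero_iff] at this
        exact Nat.eq_zero_of_dvd_of_lt this hk
      · rintro rfl; simp
    · rw [hr, (ZMod.val_injective N).eq_iff]
      constructor
      · intro e
        have e1 : (k : ZMod N) = -1 := hbinj _ _ (by rw [e]; ring)
        have : ((k + 1 : ℕ) : ZMod N) = 0 := by push_cast; rw [e1]; ring
        rw [ZMod.natCast_eq_zero_iff] at this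
        have := Nat.le_of_dvd (by omega) this
        omega
      · rintro rfl
        rw [Nat.cast_sub (by omega)]; simp
  refine ⟨fun k => m + 1 + if 1 ≤ ((k : ZMod N) * b).val ∧ ((k : ZMod N) * b).val ≤ r
    then 1 else 0, ⟨fun k => by omega, fun k => by simp, fun k hk => ?_, fun k hk => ?_⟩,
    fun k => by dsimp only; omega⟩
  · obtain ⟨h1, h2, h3, h4⟩ := key k hk _ rfl
    set v := ((k : ZMod N) * b).val
    have hw : ((((k + a : ℕ) : ZMod N)) * b).val = (v + 1) % N := by
      rw [← ZMod.val_natCast]; push_cast; rw [h4, add_mul, hab]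
    simp only [hw]
    rcases Nat.lt_or_ge (v + 1) N with hv | hv
    · rw [Nat.mod_eq_of_lt hv]
      split_ifs <;> omega
    · have : v + 1 = N := by omega
      rw [this, Nat.mod_self]
      split_ifs <;> omega
  · obtain ⟨h1, h2, h3, h4⟩ := key k hk _ rfl
    set v := ((k : ZMod N) * b).val
    have hw : ((((N - 1 - k : ℕ) : ZMod N)) * b).val = (N + r - v) % N := by
      rw [← ZMod.val_natCast]
      rw [Nat.cast_sub (by omega), Nat.cast_sub (by omega), Nat.cast_sub (by omega)]
      push_cast; rw [h4, hrb]; simp; ring_nf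
    simp only [hw]
    rcases Nat.lt_or_ge r v with hv | hv
    · rw [Nat.mod_eq_of_lt (by omega)]
      split_ifs <;> omega
    · have : N + r - v = (r - v) + N := by omega
      rw [this, Nat.add_mod_right, Nat.mod_eq_of_lt (by omega)]
      split_ifs <;> omega

section Geometry

variable {N a : ℕ} {M : ℕ → ℕ}

/-! ### Strides and corners, and how they rotate -/

lemma angle_pos (hN : 2 ≤ N) : 0 < angle N := by
  have : (0 : ℝ) < N := by positivity
  exact div_pos Real.pi_pos this

lemma mul_angle (hN : 2 ≤ N) : N * angle N = Real.pi := by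
  have : (N : ℝ) ≠ 0 := by positivity
  unfold angle; field_simp

lemma angle_half_lt (hN : 2 ≤ N) : angle N / 2 < Real.pi / 2 := by
  have h1 := mul_angle hN
  have h2 := angle_pos hN
  have : (2 : ℝ) ≤ N := by exact_mod_cast hN
  nlinarith

lemma sin_half_pos (hN : 2 ≤ N) : 0 < Real.sin (angle N / 2) :=
  Real.sin_pos_of_pos_of_lt_pi (by linarith [angle_pos hN])
    (by linarith [angle_half_lt hN, Real.pi_pos])

lemma cos_half_pos (hN : 2 ≤ N) : 0 < Real.cos (angle N / 2) :=
  Real.cos_pos_of_mem_Ioo ⟨by linarith [angle_pos hN, Real.pi_pos], angle_half_lt hN⟩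

lemma width_pos (hN : 2 ≤ N) : 0 < width N := div_pos (cos_half_pos hN) (sin_half_pos hN)

lemma stride_zero (hN : 2 ≤ N) : stride N 0 = ⟨-1, width N⟩ := by
  have := (sin_half_pos hN).ne'
  unfold stride width
  congr 1
  · rw [div_eq_iff this]; simp; ring_nf
  · simp; ring_nf

lemma stride_add (k : ℕ) : stride N (k + a) = rot N a * stride N k := by
  have e : ((k + a : ℕ) + 1 / 2 : ℝ) * angle N = (k + 1 / 2) * angle N + a * angle N := by
    push_cast; ring
  apply Complex.ext
  · simp only [stride, rot, Complex.mul_re, e, Real.sin_add]; ring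
  · simp only [stride, rot, Complex.mul_im, e, Real.cos_add]; ring

lemma rot_self (hN : 2 ≤ N) : rot N N = -1 := by
  apply Complex.ext <;> simp [rot, mul_angle hN]

lemma stride_add_self (hN : 2 ≤ N) (k : ℕ) : stride N (k + N) = -stride N k := by
  rw [stride_add, rot_self hN]; ring

lemma stride_pred (hN : 2 ≤ N) : stride N (N - 1) = ⟨-1, -width N⟩ := by
  have := (sin_half_pos hN).ne'
  have e : (((N - 1 : ℕ) : ℝ) + 1 / 2) * angle N = Real.pi - angle N / 2 := by
    rw [Nat.cast_sub (by omega), ← mul_angle hN]; push_cast; ring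
  unfold stride width
  rw [e, Real.sin_pi_sub, Real.cos_pi_sub]
  congr 1
  · field_simp
  · ring

lemma corner_succ (hN : 2 ≤ N) (h : ∀ k, M (k + N) = M k) (k : ℕ) :
    corner N M (k + 1) = corner N M k + M k * stride N k := by
  have h1 := Finset.sum_range_succ' (fun i => (M (k + i) : ℂ) * stride N (k + i)) N
  rw [Finset.sum_range_succ] at h1
  simp only [h, stride_add_self hN, add_zero] at h1
  unfold corner
  have : ∀ i, k + 1 + i = k + (i + 1) := fun i => by ring
  simp only [this]
  linear_combination (-1 / 2) * (-h1)

lemma corner_add_self (hN : 2 ≤ N) (h : ∀ k, M (k + N) = M k) (k : ℕ) :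
    corner N M (k + N) = -corner N M k := by
  unfold corner
  have : ∀ i, k + N + i = k + i + N := fun i => by ring
  simp only [this, h, stride_add_self hN, mul_neg, Finset.sum_neg_distrib]

/-- Over half a turn the shift relation adds one `stride N 0` and removes one `stride N (N - 1)`.
Their difference is vertical of height `2 * width N`, and `corner` takes half of it. -/
lemma rot_mul_corner_zero (hN : 2 ≤ N) (h : Balanced N a M) :
    rot N a * corner N M 0 = corner N M a + rot N a * ⟨0, width N⟩ := by
  have e : ∀ i ∈ range N, (M (a + i) : ℂ) * stride N (a + i) =
      rot N a * ((M i : ℂ) * stride N i) + rot N a * ((if i = 0 then stride N i else 0)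
        - (if i = N - 1 then stride N i else 0)) := by
    intro i hi
    have := h.shift i (mem_range.mp hi)
    have h2 : (M (i + a) : ℂ) = M i + (if i = 0 then 1 else 0) - (if i = N - 1 then 1 else 0) := by
      rw [eq_sub_iff_add_eq]; exact_mod_cast this
    rw [add_comm a i, stride_add, h2]
    split_ifs <;> ring
  unfold corner
  rw [Finset.sum_congr rfl e, Finset.sum_add_distrib, ← Finset.mul_sum, ← Finset.mul_sum,
    Finset.sum_sub_distrib, Finset.sum_ite_eq' , Finset.sum_ite_eq',
    if_pos (by simp; omega), if_pos (by simp; omega), stride_zero hN, stride_pred hN]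
  have : (⟨-1, width N⟩ : ℂ) - ⟨-1, -width N⟩ = 2 * ⟨0, width N⟩ := by
    apply Complex.ext <;> simp; ring
  rw [this]
  simp only [zero_add]
  ring

lemma rot_mul_corner (hN : 2 ≤ N) (h : Balanced N a M) {k : ℕ} (h0 : 1 ≤ k) (h1 : k < N) :
    rot N a * (corner N M k - 1) = corner N M (k + a) := by
  induction k, h0 using Nat.le_induction with
  | base =>
    have e := h.shift 0 (by omega)
    rw [if_neg (by omega), if_pos rfl, add_zero, zero_add] at e
    have e1 := corner_succ hN h.periodic 0
    have e2 := corner_succ hN h.periodic a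
    have e3 := stride_add (N := N) (a := a) 0
    rw [zero_add] at e1 e3
    rw [add_comm 1 a, e2, e1, e, e3, mul_sub, mul_add, rot_mul_corner_zero hN h,
      stride_zero hN]
    have : (⟨-1, width N⟩ : ℂ) = ⟨0, width N⟩ - 1 := by
      apply Complex.ext <;> simp
    rw [this]
    push_cast
    ring
  | succ k hk ih =>
    have e := h.shift k (by omega)
    rw [if_neg (by omega), if_neg (by omega), add_zero, add_zero] at e
    have e1 := corner_succ hN h.periodic k
    have e2 := corner_succ hN h.periodic (k + a)
    have e3 := stride_add (N := N) (a := a) k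
    have e4 := ih (by omega)
    rw [show k + 1 + a = k + a + 1 by ring, e2, e1, e, e3, ← e4]
    ring

/-- This is where `reflect` is needed: it places the cell at corner `0` with its lower side exactly
on the real axis. -/
lemma corner_zero_im (hN : 2 ≤ N) (h : Balanced N a M) :
    (corner N M 0).im = width N / 2 := by
  have hs := (sin_half_pos hN).ne'
  set f : ℕ → ℝ := fun i => (stride N i).im with hf
  have e0 : (corner N M 0).im = -(1 / 2) * ∑ i ∈ range N, (M i : ℝ) * f i := by
    have : (corner N M 0) = ((-(1 / 2) : ℝ) : ℂ) * ∑ i ∈ range N, ((M i : ℝ) : ℂ) * stride N i := by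
      simp [corner]
    rw [this, Complex.im_ofReal_mul, Complex.im_sum]
    simp only [Complex.im_ofReal_mul, hf]
  have e1 : ∀ i ∈ range N, (M (N - 1 - i) : ℝ) * f (N - 1 - i) =
      -((M i : ℝ) * f i) - ((if i = 0 then f i else 0) - (if i = N - 1 then f i else 0)) := by
    intro i hi
    have hi := mem_range.mp hi
    have h1 := h.reflect i hi
    have h2 : (M (N - 1 - i) : ℝ) =
        M i + (if i = 0 then 1 else 0) - (if i = N - 1 then 1 else 0) := by
      rw [eq_sub_iff_add_eq]; exact_mod_cast h1
    have h3 : f (N - 1 - i) = -f i := by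
      simp only [hf, stride]
      rw [← neg_div, ← Real.cos_pi_sub]
      congr 2
      rw [← mul_angle hN, Nat.cast_sub (by omega), Nat.cast_sub (by omega)]
      push_cast; ring
    rw [h2, h3]
    split_ifs <;> ring
  have e2 := Finset.sum_range_reflect (fun i => (M i : ℝ) * f i) N
  rw [Finset.sum_congr rfl e1, Finset.sum_sub_distrib, Finset.sum_neg_distrib,
    Finset.sum_sub_distrib, Finset.sum_ite_eq', Finset.sum_ite_eq',
    if_pos (by simp; omega), if_pos (by simp; omega)] at e2
  have f0 : f 0 = width N := by simp [hf, stride_zero hN]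
  have f1 : f (N - 1) = -width N := by simp [hf, stride_pred hN]
  rw [f0, f1] at e2
  rw [e0]
  linarith

lemma corner_add (hN : 2 ≤ N) (h : ∀ k, M (k + N) = M k) (k n : ℕ) :
    corner N M (k + n) = corner N M k + ∑ i ∈ range n, (M (k + i) : ℂ) * stride N (k + i) := by
  induction n with
  | zero => simp
  | succ n ih => rw [← add_assoc, corner_succ hN h, ih, Finset.sum_range_succ]; ring

lemma cross_stride (i j : ℕ) : cross (stride N i) (stride N j) =
    Real.sin (((i : ℝ) - j) * angle N) / Real.sin (angle N / 2) ^ 2 := by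
  have : ((i : ℝ) - j) * angle N = (i + 1 / 2) * angle N - (j + 1 / 2) * angle N := by ring
  rw [this, Real.sin_sub]
  simp only [cross, stride]
  ring

lemma cross_rot (u v : ℂ) : cross (rot N a * u) (rot N a * v) = cross u v := by
  simp only [cross, rot, Complex.mul_re, Complex.mul_im]
  have := Real.sin_sq_add_cos_sq (a * angle N)
  linear_combination (u.im * v.re - u.re * v.im) * this

lemma rot_mul_corner_zero_sub_one (hN : 2 ≤ N) (h : Balanced N a M) :
    rot N a * (corner N M 0 - 1) = corner N M a + stride N a := by
  have e3 := stride_add (N := N) (a := a) 0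
  rw [zero_add] at e3
  rw [mul_sub, rot_mul_corner_zero hN h, e3, stride_zero hN]
  have : (⟨-1, width N⟩ : ℂ) = ⟨0, width N⟩ - 1 := by apply Complex.ext <;> simp
  rw [this]; ring

lemma stride_im_antitone (hN : 2 ≤ N) {i j : ℕ} (hij : i ≤ j) (hj : j < N) :
    (stride N j).im ≤ (stride N i).im := by
  have ha := angle_pos hN
  have hs := sin_half_pos hN
  have h1 : (i : ℝ) ≤ j := by exact_mod_cast hij
  have h2 : (j : ℝ) + 1 ≤ N := by exact_mod_cast hj
  simp only [stride]
  gcongr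
  apply Real.cos_le_cos_of_nonneg_of_le_pi
  · positivity
  · rw [← mul_angle hN]; gcongr; linarith
  · gcongr

/-! ### The necklace of cells is invariant -/

/-- The heights of the strides decrease with `k`, so along the upper half the necklace first climbs
and then descends. The minimum is at an end: corner `0`, or the last link before corner `N`, both at
height `width N / 2`. -/
lemma centre_im (hN : 2 ≤ N) (h : Balanced N a M) {k j : ℕ} (hk : k < N) (hj : j < M k) :
    width N / 2 ≤ (corner N M k + j * stride N k).im := by
  have hmul : ∀ (n : ℕ) (w : ℂ), ((n : ℂ) * w).im = n * w.im := fun n w => by simp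
  have h0 := corner_zero_im hN h
  rw [Complex.add_im, hmul]
  rcases le_or_gt 0 (stride N k).im with hf | hf
  · have e := congrArg Complex.im (corner_add hN h.periodic 0 k)
    simp only [zero_add, Complex.add_im, Complex.im_sum, hmul] at e
    have : 0 ≤ ∑ i ∈ range k, (M i : ℝ) * (stride N i).im :=
      Finset.sum_nonneg fun i hi => mul_nonneg (Nat.cast_nonneg _)
        (hf.trans (stride_im_antitone hN (mem_range.mp hi).le hk))
    have : 0 ≤ (j : ℝ) * (stride N k).im := by positivity
    linarith
  · have e := congrArg Complex.im (corner_add hN h.periodic k (N - k))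
    have e2 := congrArg Complex.im (corner_add_self hN h.periodic 0)
    rw [zero_add, Complex.neg_im, h0] at e2
    rw [Nat.add_sub_cancel' hk.le, e2] at e
    simp only [Complex.add_im, Complex.im_sum, hmul] at e
    -- Descending case: count the links left from this centre to corner `N`, at height `-width N /
    -- 2`. The last of them alone drops by `width N`.
    set m : ℕ → ℕ := fun i => M (k + i) - if i = 0 then j else 0
    have hm : ∀ i, 1 ≤ m i := by
      intro i
      have := h.pos (k + i)
      by_cases hi : i = 0
      · subst hi; simp only [m, if_pos, add_zero]; omega
      · simp only [m, if_neg hi]; omega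
    have hM : ∀ i, (M (k + i) : ℝ) = m i + if i = 0 then (j : ℝ) else 0 := by
      intro i
      by_cases hi : i = 0
      · subst hi; simp only [m, if_pos, add_zero]; rw [Nat.cast_sub hj.le]; ring
      · simp only [m, if_neg hi]; simp
    have e3 : ∑ i ∈ range (N - k), (M (k + i) : ℝ) * (stride N (k + i)).im
        = ∑ i ∈ range (N - k), (m i : ℝ) * (stride N (k + i)).im + j * (stride N k).im := by
      simp only [hM, add_mul, Finset.sum_add_distrib, ite_mul, zero_mul]
      rw [Finset.sum_ite_eq' (range (N - k)) 0 (fun i => (j : ℝ) * (stride N (k + i)).im),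
        if_pos (by simp; omega), add_zero]
    have hneg : ∀ i ∈ range (N - k), 0 ≤ -((m i : ℝ) * (stride N (k + i)).im) := by
      intro i hi
      have hi := mem_range.mp hi
      have := stride_im_antitone hN (Nat.le_add_right k i) (by omega)
      have h1 : (0 : ℝ) ≤ m i := Nat.cast_nonneg _
      nlinarith
    have e4 := Finset.single_le_sum hneg (mem_range.mpr (show N - k - 1 < N - k by omega))
    rw [Finset.sum_neg_distrib, show k + (N - k - 1) = N - 1 by omega, stride_pred hN] at e4
    have h1 : (1 : ℝ) ≤ m (N - k - 1) := by exact_mod_cast hm _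
    have h2 := width_pos hN
    simp only at e4
    nlinarith

lemma neg_mem_centres (hN : 2 ≤ N) (h : Balanced N a M) {c : ℂ} (hc : c ∈ centres N M) :
    -c ∈ centres N M := by
  obtain ⟨k, j, hj, rfl⟩ := hc
  exact ⟨k + N, j, by rwa [h.periodic], by
    rw [corner_add_self hN h.periodic, stride_add_self hN]; ring⟩

lemma centres_cases (hN : 2 ≤ N) (h : Balanced N a M) {c : ℂ} (hc : c ∈ centres N M) :
    ∃ k < N, ∃ j < M k, c = corner N M k + j * stride N k ∨
      c = -(corner N M k + j * stride N k) := by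
  obtain ⟨k, j, hj, rfl⟩ := hc
  induction k using Nat.strong_induction_on with
  | _ k ih =>
    rcases Nat.lt_or_ge k N with hk | hk
    · exact ⟨k, hk, j, hj, Or.inl rfl⟩
    · obtain ⟨l, rfl⟩ := Nat.exists_eq_add_of_le' hk
      rw [h.periodic] at hj
      obtain ⟨k', hk', j', hj', e⟩ := ih l (by omega) hj
      refine ⟨k', hk', j', hj', ?_⟩
      have e' : corner N M (l + N) + j * stride N (l + N) = -(corner N M l + j * stride N l) := by
        rw [corner_add_self hN h.periodic, stride_add_self hN]; ring
      rw [e']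
      rcases e with e | e
      · right; rw [e]
      · left; rw [e, neg_neg]

lemma H_of_pos {z : ℂ} (hz : 0 ≤ z.im) : H z = 1 := if_pos hz

lemma H_of_neg {z : ℂ} (hz : z.im < 0) : H z = -1 := if_neg (not_le.mpr hz)

lemma F_neg (lam : ℂ) {z : ℂ} (hz : z.im ≠ 0) : F lam (-z) = -F lam z := by
  unfold F
  rcases lt_or_gt_of_ne hz with h | h
  · rw [H_of_neg h, H_of_pos (by simp; linarith)]; ring
  · rw [H_of_pos h.le, H_of_neg (by simp; linarith)]; ring

lemma F_centre_upper (hN : 2 ≤ N) (h : Balanced N a M) {k j : ℕ} (hk : k < N) (hj : j < M k) :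
    F (rot N a) (corner N M k + j * stride N k) ∈ centres N M := by
  have h1 := centre_im hN h hk hj
  have h2 := width_pos hN
  rw [F, H_of_pos (by linarith)]
  have hs := h.shift k hk
  have e : rot N a * (corner N M k + j * stride N k - 1)
      = rot N a * (corner N M k - 1) + j * stride N (k + a) := by rw [stride_add]; ring
  rw [e]
  rcases Nat.eq_zero_or_pos k with rfl | hk0
  · rw [if_neg (by omega), if_pos rfl, zero_add, add_zero] at hs
    -- Side `0` gains a link at its start, so indices move up by one.
    refine ⟨a, j + 1, by omega, ?_⟩
    rw [rot_mul_corner_zero_sub_one hN h, zero_add]; push_cast; ring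
  · rw [if_neg (by omega : k ≠ 0)] at hs
    rw [rot_mul_corner hN h hk0 hk]
    rcases Nat.lt_or_ge j (M (k + a)) with hj' | hj'
    · exact ⟨k + a, j, hj', rfl⟩
    -- Side `N - 1` loses a link, so its last centre lands on the next corner.
    · refine ⟨k + a + 1, 0, h.pos _, ?_⟩
      have : j = M (k + a) := by split_ifs at hs <;> omega
      rw [corner_succ hN h.periodic, this]; simp

lemma F_mem_centres (hN : 2 ≤ N) (h : Balanced N a M) {c : ℂ} (hc : c ∈ centres N M) :
    F (rot N a) c ∈ centres N M := by
  obtain ⟨k, hk, j, hj, rfl | rfl⟩ := centres_cases hN h hc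
  · exact F_centre_upper hN h hk hj
  · have h1 := centre_im hN h hk hj
    have h2 := width_pos hN
    rw [F_neg _ (by linarith)]
    exact neg_mem_centres hN h (F_centre_upper hN h hk hj)

lemma centres_im_abs (hN : 2 ≤ N) (h : Balanced N a M) {c : ℂ} (hc : c ∈ centres N M) :
    width N / 2 ≤ |c.im| := by
  obtain ⟨k, hk, j, hj, rfl | rfl⟩ := centres_cases hN h hc
  · exact (centre_im hN h hk hj).trans (le_abs_self _)
  · rw [Complex.neg_im, abs_neg]
    exact (centre_im hN h hk hj).trans (le_abs_self _)

lemma rot_mul_mem_cell {u : ℂ} (hu : u ∈ cell N) : rot N a * u ∈ cell N := by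
  intro k
  convert hu (k + a) using 2
  simp only [rot, Complex.mul_re, Complex.mul_im]
  rw [Nat.cast_add, add_mul (k : ℝ), Real.cos_add, Real.sin_add]
  ring

/-- A cell meets the real axis at most along its boundary, so `z` and `c` lie on the same side and
are moved by the same rigid motion. -/
lemma F_mem_cells (hN : 2 ≤ N) (h : Balanced N a M) {z c : ℂ} (hc : c ∈ centres N M)
    (hz : z - c ∈ cell N) (him : z.im ≠ 0) :
    F (rot N a) c ∈ centres N M ∧ F (rot N a) z - F (rot N a) c ∈ cell N := by
  refine ⟨F_mem_centres hN h hc, ?_⟩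
  have h1 := centres_im_abs hN h hc
  have h2 := width_pos hN
  have h3 := hz 0
  simp only [Nat.cast_zero, zero_mul, Real.cos_zero, Real.sin_zero, mul_one, mul_zero,
    add_zero, Complex.sub_im] at h3
  have e : H z = H c := by
    rw [abs_le] at h3
    rcases le_abs.mp h1 with h4 | h4
    · rw [H_of_pos (by linarith), H_of_pos (by linarith)]
    · rw [H_of_neg (show c.im < 0 by linarith), H_of_neg (lt_of_le_of_ne (by linarith) him)]
  have : F (rot N a) z - F (rot N a) c = rot N a * (z - c) := by
    unfold F; rw [e]; ring
  rw [this]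
  exact rot_mul_mem_cell hz

/-! ### Points of the polygon stay in the necklace region -/

lemma abs_cos_odd_half (hN : 2 ≤ N) (k : ℕ) :
    |Real.cos (k * angle N - angle N / 2)| ≤ Real.cos (angle N / 2) := by
  have ha := angle_pos hN
  induction k using Nat.strong_induction_on with
  | _ k ih =>
    rcases Nat.lt_or_ge N k with hk | hk
    · have := ih (k - N) (by omega)
      rw [Nat.cast_sub hk.le, sub_mul, mul_angle hN] at this
      rwa [show k * angle N - Real.pi - angle N / 2 = k * angle N - angle N / 2 - Real.pi by ring,
        Real.cos_sub_pi, abs_neg] at this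
    · have hp := mul_angle hN
      have hk' : (k : ℝ) ≤ N := by exact_mod_cast hk
      rcases Nat.eq_zero_or_pos k with rfl | h0
      · rw [Nat.cast_zero, zero_mul, zero_sub, Real.cos_neg, abs_of_pos (cos_half_pos hN)]
      have h0' : (1 : ℝ) ≤ k := by exact_mod_cast h0
      rw [abs_le]
      constructor
      · rw [← Real.cos_pi_sub]
        apply Real.cos_le_cos_of_nonneg_of_le_pi <;> nlinarith
      · apply Real.cos_le_cos_of_nonneg_of_le_pi <;> nlinarith

lemma triangle_subset_cell (hN : 2 ≤ N) {u : ℂ} (h1 : width N * |u.re| ≤ u.im)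
    (h2 : u.im ≤ width N / 2) : u ∈ cell N := by
  intro k
  have hc := cos_half_pos hN
  have hs := sin_half_pos hN
  have hw := width_pos hN
  have hy : 0 ≤ u.im := le_trans (by positivity) h1
  have hx : |u.re| * Real.cos (angle N / 2) ≤ u.im * Real.sin (angle N / 2) := by
    have : width N * Real.sin (angle N / 2) = Real.cos (angle N / 2) := by
      unfold width; field_simp
    nlinarith
  -- The bound is homogeneous, so it need only be tested on the two edges of the triangle at its
  -- apex. There it compares the cosine of an odd multiple of `angle N / 2` with `cos (angle N /
  -- 2)`.
  have key : ∀ C S : ℝ, |C * Real.cos (angle N / 2) + S * Real.sin (angle N / 2)| ≤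
      Real.cos (angle N / 2) → |C * Real.cos (angle N / 2) - S * Real.sin (angle N / 2)| ≤
      Real.cos (angle N / 2) → |u.im * C + u.re * S| ≤ u.im := by
    intro C S h3 h4
    rw [abs_le] at h3 h4
    have h5 := abs_le.mp (le_refl |u.re|)
    rw [abs_le]
    have hxS : |u.re * S| * Real.cos (angle N / 2) ≤ u.im * (|S| * Real.sin (angle N / 2)) := by
      rw [abs_mul]
      nlinarith [abs_nonneg S]
    have h6 := abs_le.mp (le_refl |u.re * S|)
    have h7 : u.im * (C * Real.cos (angle N / 2) + |S| * Real.sin (angle N / 2)) ≤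
        u.im * Real.cos (angle N / 2) := by
      apply mul_le_mul_of_nonneg_left _ hy
      rcases abs_cases S with ⟨e, -⟩ | ⟨e, -⟩ <;> rw [e] <;> linarith
    have h8 : u.im * -(C * Real.cos (angle N / 2) - |S| * Real.sin (angle N / 2)) ≤
        u.im * Real.cos (angle N / 2) := by
      apply mul_le_mul_of_nonneg_left _ hy
      rcases abs_cases S with ⟨e, -⟩ | ⟨e, -⟩ <;> rw [e] <;> linarith
    constructor
    · apply le_of_mul_le_mul_right _ hc
      nlinarith
    · apply le_of_mul_le_mul_right _ hc
      nlinarith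
  refine (key _ _ ?_ ?_).trans h2
  · rw [← Real.cos_sub]
    exact abs_cos_odd_half hN k
  · rw [← Real.cos_add]
    have := abs_cos_odd_half hN (k + 1)
    push_cast at this
    rwa [show ((k : ℝ) + 1) * angle N - angle N / 2 = k * angle N + angle N / 2 by ring] at this

lemma sin_mul_angle_nonneg (hN : 2 ≤ N) {j : ℕ} (hj : j ≤ N) : 0 ≤ Real.sin (j * angle N) := by
  have ha := angle_pos hN
  have : (j : ℝ) ≤ N := by exact_mod_cast hj
  apply Real.sin_nonneg_of_nonneg_of_le_pi (by positivity)
  rw [← mul_angle hN]; gcongr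

lemma mem_polygon_of_shift (hN : 2 ≤ N) (h : Balanced N a M) {w : ℂ}
    (hw : ∀ k < 2 * N, 0 ≤ cross (w - corner N M (k + a)) (stride N (k + a))) :
    w ∈ polygon N M := by
  intro l
  have hper : Function.Periodic (fun k => cross (w - corner N M k) (stride N k)) (2 * N) := by
    intro k
    simp only [two_mul, ← add_assoc, corner_add_self hN h.periodic, stride_add_self hN, neg_neg]
  have h0 : 0 < 2 * N := by omega
  -- Adding the multiple `a * (2 * N)` of the period keeps the natural subtraction from truncating.
  have h1 := hw ((l + a * (2 * N) - a) % (2 * N)) (Nat.mod_lt _ h0)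
  have h2 : a ≤ a * (2 * N) := Nat.le_mul_of_pos_right _ h0
  have e : ((l + a * (2 * N) - a) % (2 * N) + a) % (2 * N) = l % (2 * N) := by
    rw [Nat.mod_add_mod, Nat.sub_add_cancel (by omega), Nat.add_mul_mod_self_right]
  have e1 := hper.map_mod_nat ((l + a * (2 * N) - a) % (2 * N) + a)
  have e2 := hper.map_mod_nat l
  rw [e, e2] at e1
  rw [e1]; exact h1

lemma neg_mem_polygon (hN : 2 ≤ N) (h : Balanced N a M) {z : ℂ} (hz : z ∈ polygon N M) :
    -z ∈ polygon N M := by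
  intro k
  have := hz (k + N)
  rw [corner_add_self hN h.periodic, stride_add_self hN] at this
  convert this using 1
  simp [cross]; ring

lemma cross_corner_sub (hN : 2 ≤ N) (h : Balanced N a M) {j : ℕ} (h0 : 1 ≤ j) (hj : j < N) :
    Real.sin (j * angle N) / Real.sin (angle N / 2) ^ 2 ≤
      cross (corner N M 0 - corner N M j) (stride N j) := by
  have e := corner_add hN h.periodic 0 j
  simp only [zero_add] at e
  have e1 : cross (corner N M 0 - corner N M j) (stride N j) =
      ∑ i ∈ range j, (M i : ℝ) * -cross (stride N i) (stride N j) := by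
    rw [e, sub_add_cancel_left]
    simp only [cross, Complex.neg_im, Complex.neg_re, Complex.im_sum, Complex.re_sum,
      Complex.mul_im, Complex.mul_re, Complex.natCast_re, Complex.natCast_im, zero_mul,
      add_zero, sub_zero, Finset.sum_mul, neg_mul]
    rw [sub_neg_eq_add, neg_add_eq_sub, ← Finset.sum_sub_distrib]
    exact Finset.sum_congr rfl fun i _ => by ring
  have e2 : ∀ i ≤ j, -cross (stride N i) (stride N j) =
      Real.sin ((j - i : ℕ) * angle N) / Real.sin (angle N / 2) ^ 2 := by
    intro i hi
    rw [cross_stride, ← neg_div, ← Real.sin_neg, Nat.cast_sub hi]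
    congr 2; ring
  rw [e1]
  have e3 := Finset.single_le_sum (f := fun i => (M i : ℝ) * -cross (stride N i) (stride N j))
    (s := range j) (fun i hi => by
      have hi := mem_range.mp hi
      rw [e2 i hi.le]
      have := sin_mul_angle_nonneg hN (j := j - i) (by omega)
      positivity) (mem_range.mpr (show 0 < j by omega))
  refine le_trans ?_ e3
  rw [e2 0 (by omega), Nat.sub_zero]
  have h1 : (1 : ℝ) ≤ M 0 := by exact_mod_cast h.pos 0
  have h2 := sin_mul_angle_nonneg hN hj.le
  exact le_mul_of_one_le_left (by positivity) h1

/-- Says that moving `z` two units to the right does not cross side `j`. An ascending stride is a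
nonnegative combination of `stride N 0` and the leftward horizontal, so `z` is to the left of the
parallel to side `j` through corner `0`. That parallel is already far enough inside, since side `0`
has at least one link. -/
lemma two_mul_stride_im_le (hN : 2 ≤ N) (h : Balanced N a M) {z : ℂ} (hz : z ∈ polygon N M)
    (him : z.im < 0) {j : ℕ} (h0 : 1 ≤ j) (hj : j < N) :
    2 * (stride N j).im ≤ cross (z - corner N M j) (stride N j) := by
  rcases le_or_gt (stride N j).im 0 with hn | hp
  · linarith [hz j]
  have ha := angle_pos hN
  have hs := sin_half_pos hN
  have hc := cos_half_pos hN
  have hw := width_pos hN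
  have hpi := mul_angle hN
  have hjN : (j : ℝ) + 1 ≤ N := by exact_mod_cast hj
  have hj1 : (1 : ℝ) ≤ j := by exact_mod_cast h0
  have hj0 := sin_mul_angle_nonneg hN hj.le
  have hlt : (j + 1 / 2) * angle N < Real.pi / 2 := by
    by_contra hcon
    have : (stride N j).im ≤ 0 := by
      simp only [stride]
      apply div_nonpos_of_nonpos_of_nonneg _ hs.le
      apply Real.cos_nonpos_of_pi_div_two_le_of_le (by linarith)
      nlinarith [Real.pi_pos]
    linarith
  have hsin : 2 * Real.sin (angle N / 2) * Real.cos (angle N / 2) ≤ Real.sin (j * angle N) := by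
    rw [← Real.sin_two_mul]
    apply Real.sin_le_sin_of_le_of_le_pi_div_two <;> nlinarith
  have hexp : (j + 1 / 2) * angle N = j * angle N + angle N / 2 := by ring
  have him_eq : (stride N j).im = (Real.cos (j * angle N) * Real.cos (angle N / 2) -
      Real.sin (j * angle N) * Real.sin (angle N / 2)) / Real.sin (angle N / 2) := by
    rw [← Real.cos_add, ← hexp]; rfl
  have hre_eq : (stride N j).re = -(Real.sin (j * angle N) * Real.cos (angle N / 2) +
      Real.cos (j * angle N) * Real.sin (angle N / 2)) / Real.sin (angle N / 2) := by
    rw [← Real.sin_add, ← hexp]; rfl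
  set p := (stride N j).im / width N with hpdef
  have hp0 : 0 ≤ p := by positivity
  have him' : (stride N j).im = p * width N := by rw [hpdef]; field_simp
  set r := -p - (stride N j).re with hr
  have hr0 : 0 ≤ r := by
    have : r = Real.sin (j * angle N) / (Real.sin (angle N / 2) * Real.cos (angle N / 2)) := by
      rw [hr, hpdef, him_eq, hre_eq, width]
      field_simp
      linear_combination Real.sin (j * angle N) * Real.sin_sq_add_cos_sq (angle N / 2)
    rw [this]; positivity
  have hre' : (stride N j).re = -p - r := by rw [hr]; ring
  have hz0 := hz 0
  have hV := corner_zero_im hN h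
  have h1 : 0 ≤ cross (z - corner N M 0) (stride N j) := by
    rw [stride_zero hN] at hz0
    simp only [cross, Complex.sub_im, Complex.sub_re] at hz0 ⊢
    rw [him', hre']
    nlinarith [mul_nonneg hp0 hz0]
  have h2 := cross_corner_sub hN h h0 hj
  have h3 : cross (z - corner N M j) (stride N j) = cross (z - corner N M 0) (stride N j) +
      cross (corner N M 0 - corner N M j) (stride N j) := by
    simp only [cross, Complex.sub_im, Complex.sub_re]; ring
  have h4 : 2 * (stride N j).im ≤ Real.sin (j * angle N) / Real.sin (angle N / 2) ^ 2 := by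
    rw [him_eq, le_div_iff₀ (by positivity)]
    field_simp
    have hcos := Real.cos_le_one (j * angle N)
    have : 2 * Real.sin (angle N / 2) * Real.cos (angle N / 2) * Real.cos (j * angle N) ≤
        2 * Real.sin (angle N / 2) * Real.cos (angle N / 2) * 1 :=
      mul_le_mul_of_nonneg_left hcos (by positivity)
    have : 0 ≤ Real.sin (j * angle N) * Real.sin (angle N / 2) ^ 2 := by positivity
    nlinarith
  linarith

/-- After undoing the rotation, the lower sides impose the old conditions on `z`, while the upper
sides impose theirs on `z + 2`. Only side `0` can fail, and the points where it fails form a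
triangle inside the cell just below corner `0`. -/
lemma F_mem_polygon_or_cell (hN : 2 ≤ N) (h : Balanced N a M) {z : ℂ} (hz : z ∈ polygon N M)
    (him : z.im < 0) :
    F (rot N a) z ∈ polygon N M ∨ ∃ c ∈ centres N M, z - c ∈ cell N := by
  have hw := width_pos hN
  rcases le_or_gt (2 * width N) (cross (z - corner N M 0) (stride N 0)) with h0 | h0
  · left
    have hF : F (rot N a) z = rot N a * (z + 1) := by rw [F, H_of_neg him]; ring
    rw [hF]
    apply mem_polygon_of_shift hN h
    have upper : ∀ j < N, ∀ w, cross (rot N a * w - corner N M (j + a)) (stride N (j + a)) =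
        cross (w + 1 - corner N M j) (stride N j) := by
      intro j hj w
      rcases Nat.eq_zero_or_pos j with rfl | hj0
      · have e := rot_mul_corner_zero_sub_one hN h
        have e2 := stride_add (N := N) (a := a) 0
        rw [zero_add] at e2 ⊢
        have : rot N a * w - corner N M a =
            rot N a * (w + 1 - corner N M 0 + stride N 0) := by
          linear_combination e + e2
        rw [this, e2, cross_rot]
        simp only [cross, Complex.add_im, Complex.add_re]; ring
      · rw [← rot_mul_corner hN h hj0 hj, stride_add, ← mul_sub, cross_rot]
        congr 1; ring
    intro k hk
    rcases Nat.lt_or_ge k N with hkN | hkN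
    · rw [upper k hkN]
      have e : cross (z + 1 + 1 - corner N M k) (stride N k) =
          cross (z - corner N M k) (stride N k) - 2 * (stride N k).im := by
        simp only [cross, Complex.add_im, Complex.add_re, Complex.sub_im, Complex.sub_re,
          Complex.one_im, Complex.one_re]; ring
      rw [e, sub_nonneg]
      rcases Nat.eq_zero_or_pos k with rfl | hk0
      · simpa [stride_zero hN] using h0
      · exact two_mul_stride_im_le hN h hz him hk0 hkN
    · obtain ⟨j, rfl⟩ := Nat.exists_eq_add_of_le' hkN
      have e := upper j (by omega) (-(z + 1))
      have e2 := hz (j + N)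
      rw [corner_add_self hN h.periodic, stride_add_self hN] at e2
      rw [add_right_comm, corner_add_self hN h.periodic, stride_add_self hN]
      have e3 : cross (rot N a * (z + 1) - -corner N M (j + a)) (-stride N (j + a)) =
          cross (rot N a * -(z + 1) - corner N M (j + a)) (stride N (j + a)) := by
        rw [mul_neg]; simp only [cross, Complex.sub_im, Complex.sub_re, Complex.neg_im,
          Complex.neg_re]; ring
      rw [e3, e]
      convert e2 using 1
      simp only [cross, Complex.sub_im, Complex.sub_re, Complex.neg_im, Complex.add_im,
        Complex.add_re, Complex.neg_re]; ring
  · right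
    have hV := corner_zero_im hN h
    have hS := stride_zero hN
    have hS' := stride_pred hN
    have e1 := corner_succ hN h.periodic (N - 1)
    have e0 := corner_add_self hN h.periodic 0
    rw [show N - 1 + 1 = 0 + N by omega, e0] at e1
    have hMp := h.pos (N - 1)
    -- The link preceding corner `0`, being opposite to the last link of side `N - 1`.
    refine ⟨corner N M 0 + stride N (N - 1), ?_, ?_⟩
    · rw [← neg_neg (corner N M 0 + stride N (N - 1))]
      apply neg_mem_centres hN h
      refine ⟨N - 1, M (N - 1) - 1, by omega, ?_⟩
      rw [Nat.cast_sub hMp]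
      push_cast
      linear_combination e1
    · have h1 := hz (N - 1 + N)
      rw [corner_add_self hN h.periodic, stride_add_self hN] at h1
      have e2 : corner N M (N - 1) = -corner N M 0 - M (N - 1) * stride N (N - 1) := by
        rw [e1]; ring
      rw [e2, hS'] at h1
      rw [hS] at h0
      simp only [cross, Complex.sub_im, Complex.sub_re, Complex.neg_im, Complex.neg_re,
        Complex.mul_im, Complex.mul_re, Complex.natCast_re, Complex.natCast_im] at h0 h1
      rw [hS']
      apply triangle_subset_cell hN
      · simp only [Complex.sub_im, Complex.sub_re, Complex.add_im, Complex.add_re]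
        rcases abs_cases (z.re - ((corner N M 0).re + -1)) with ⟨e, -⟩ | ⟨e, -⟩ <;> rw [e] <;>
          nlinarith
      · simp only [Complex.sub_im, Complex.add_im]
        linarith

lemma F_mem_necklaceRegion (hN : 2 ≤ N) (h : Balanced N a M) {z : ℂ}
    (hz : z ∈ necklaceRegion N M) (him : z.im ≠ 0) :
    F (rot N a) z ∈ necklaceRegion N M := by
  rcases hz with hz | ⟨c, hc, hz⟩
  · rcases lt_or_gt_of_ne him with hlt | hgt
    · rcases F_mem_polygon_or_cell hN h hz hlt with h1 | ⟨c, hc, h1⟩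
      · exact Or.inl h1
      · exact Or.inr ⟨_, F_mem_cells hN h hc h1 him⟩
    · rcases F_mem_polygon_or_cell hN h (neg_mem_polygon hN h hz) (by simpa using hgt) with
        h1 | ⟨c, hc, h1⟩
      · rw [F_neg _ him] at h1
        exact Or.inl (by simpa using neg_mem_polygon hN h h1)
      · refine Or.inr ⟨_, F_mem_cells hN h (neg_mem_centres hN h hc) ?_ him⟩
        intro k
        have := h1 k
        rw [← abs_neg] at this
        convert this using 2
        simp; ring
  · exact Or.inr ⟨_, F_mem_cells hN h hc hz him⟩

/-! ### Exhaustion of the plane and bounded orbits -/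

lemma exists_mem_polygon (hN : 2 ≤ N) (h : Nat.Coprime a N) (z : ℂ) :
    ∃ M, Balanced N a M ∧ z ∈ polygon N M := by
  have hs := sin_half_pos hN
  have hc := cos_half_pos hN
  set s := Real.sin (angle N / 2) with hsdef
  have hsin : Real.sin (angle N) = 2 * s * Real.cos (angle N / 2) := by
    rw [hsdef, ← Real.sin_two_mul]; congr 1; ring
  have hsp : 0 < Real.sin (angle N) := by rw [hsin]; positivity
  obtain ⟨m, hm⟩ := exists_nat_ge (2 * s * (|z.im| + |z.re|) / Real.sin (angle N))
  obtain ⟨M, hM, hmM⟩ := balanced_exists N a m hN h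
  refine ⟨M, hM, fun k => ?_⟩
  have e1 : cross (z - corner N M k) (stride N k) = cross z (stride N k) +
      1 / 2 * ∑ i ∈ range N, (M (k + i) : ℝ) * cross (stride N (k + i)) (stride N k) := by
    have : corner N M k = ((-(1 / 2) : ℝ) : ℂ) *
        ∑ i ∈ range N, ((M (k + i) : ℝ) : ℂ) * stride N (k + i) := by simp [corner]
    rw [this]
    simp only [cross, Complex.sub_im, Complex.sub_re, Complex.im_ofReal_mul,
      Complex.re_ofReal_mul, Complex.im_sum, Complex.re_sum, mul_sub, Finset.sum_sub_distrib,
      ← mul_assoc, ← Finset.sum_mul]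
    ring
  have e2 : ∀ i, cross (stride N (k + i)) (stride N k) = Real.sin (i * angle N) / s ^ 2 := by
    intro i; rw [cross_stride]; push_cast; rw [add_sub_cancel_left]
  -- All contributions to the distance from side `k` are nonnegative, and the adjacent side `k + 1`
  -- alone makes it large.
  have e3 := Finset.single_le_sum
    (f := fun i => (M (k + i) : ℝ) * cross (stride N (k + i)) (stride N k)) (s := range N)
    (fun i hi => by
      rw [e2]
      have := sin_mul_angle_nonneg hN (mem_range.mp hi).le
      positivity) (mem_range.mpr (show 1 < N by omega))
  simp only [e2, Nat.cast_one, one_mul] at e1 e3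
  rw [e1]
  have h1 : (m : ℝ) ≤ M (k + 1) := by exact_mod_cast hmM _
  have h2 : -(|z.im| + |z.re|) / s ≤ cross z (stride N k) := by
    rw [div_le_iff₀ hs]
    have : cross z (stride N k) * s = z.im * -Real.sin ((k + 1 / 2) * angle N)
        - z.re * Real.cos ((k + 1 / 2) * angle N) := by
      simp only [cross, stride, ← hsdef]; field_simp
    rw [this]
    have h3 : |z.im * -Real.sin ((k + 1 / 2) * angle N)| ≤ |z.im| := by
      rw [abs_mul, abs_neg]
      exact mul_le_of_le_one_right (abs_nonneg _) (Real.abs_sin_le_one _)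
    have h4 : |z.re * Real.cos ((k + 1 / 2) * angle N)| ≤ |z.re| := by
      rw [abs_mul]
      exact mul_le_of_le_one_right (abs_nonneg _) (Real.abs_cos_le_one _)
    have := (abs_le.mp h3).1
    have := (abs_le.mp h4).2
    linarith
  have h5 : 2 * ((|z.im| + |z.re|) / s) ≤ M (k + 1) * (Real.sin (angle N) / s ^ 2) := by
    rw [div_le_iff₀ hsp] at hm
    rw [← mul_div_assoc, ← mul_div_assoc, div_le_div_iff₀ hs (by positivity)]
    have : (m : ℝ) * Real.sin (angle N) ≤ M (k + 1) * Real.sin (angle N) := by gcongr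
    nlinarith
  rw [neg_div] at h2
  linarith

lemma necklaceRegion_bounded (hN : 2 ≤ N) (h : Balanced N a M) :
    Bornology.IsBounded (necklaceRegion N M) := by
  have hw := width_pos hN
  apply Bornology.IsBounded.union
  · have hbound : ∀ k, ∀ z ∈ polygon N M,
        |cross z (stride N k)| ≤ |cross (corner N M k) (stride N k)| := by
      intro k z hz
      have h1 := hz k
      have h2 := neg_mem_polygon hN h hz k
      have h3 : cross (z - corner N M k) (stride N k) =
          cross z (stride N k) - cross (corner N M k) (stride N k) := by
        simp only [cross, Complex.sub_im, Complex.sub_re]; ring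
      have h4 : cross (-z - corner N M k) (stride N k) =
          -cross z (stride N k) - cross (corner N M k) (stride N k) := by
        simp only [cross, Complex.sub_im, Complex.sub_re, Complex.neg_im, Complex.neg_re]; ring
      rw [abs_le, abs_of_nonpos (by linarith)]
      constructor <;> linarith
    set B := |cross (corner N M 0) (stride N 0)| + |cross (corner N M (N - 1)) (stride N (N - 1))|
    rw [isBounded_iff_forall_norm_le]
    refine ⟨B / width N + B, fun z hz => ?_⟩
    have h1 := abs_le.mp (hbound 0 z hz)
    have h2 := abs_le.mp (hbound (N - 1) z hz)
    have e1 : cross z (stride N 0) = -z.im - z.re * width N := by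
      rw [stride_zero hN]; simp [cross]
    have e2 : cross z (stride N (N - 1)) = -z.im + z.re * width N := by
      rw [stride_pred hN]; simp [cross]
    rw [e1] at h1
    rw [e2] at h2
    have hB : 0 ≤ B := by positivity
    refine (Complex.norm_le_abs_re_add_abs_im z).trans (add_le_add ?_ ?_)
    · rw [le_div_iff₀ hw, ← abs_of_pos hw, ← abs_mul, abs_le]
      constructor <;> simp only [B] at * <;> linarith
    · rw [abs_le]
      constructor <;> simp only [B] at * <;> linarith
  · have ha : 0 < Real.sin (angle N) := by
      have := sin_half_pos hN
      have := cos_half_pos hN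
      rw [show angle N = 2 * (angle N / 2) by ring, Real.sin_two_mul]; positivity
    have hcell : ∀ u ∈ cell N, ‖u‖ ≤ width N / Real.sin (angle N) + width N / 2 := by
      intro u hu
      have h0 := hu 0
      have h1 := hu 1
      simp only [Nat.cast_zero, zero_mul, Real.cos_zero, Real.sin_zero, mul_one, mul_zero,
        add_zero, Nat.cast_one, one_mul] at h0 h1
      refine (Complex.norm_le_abs_re_add_abs_im u).trans (add_le_add ?_ h0)
      rw [le_div_iff₀ ha, ← abs_of_pos ha, ← abs_mul]
      have h2 : |u.im * Real.cos (angle N)| ≤ |u.im| := by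
        rw [abs_mul]; exact mul_le_of_le_one_right (abs_nonneg _) (Real.abs_cos_le_one _)
      have h3 := abs_le.mp (h2.trans h0)
      rw [abs_le] at h1 ⊢
      constructor <;> linarith
    rw [isBounded_iff_forall_norm_le]
    refine ⟨∑ k ∈ range N, (‖corner N M k‖ + M k * ‖stride N k‖) +
      (width N / Real.sin (angle N) + width N / 2), ?_⟩
    rintro z ⟨c, hc, hz⟩
    have h1 : ‖c‖ ≤ ∑ k ∈ range N, (‖corner N M k‖ + M k * ‖stride N k‖) := by
      obtain ⟨k, hk, j, hj, e⟩ := centres_cases hN h hc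
      have e2 : ‖c‖ = ‖corner N M k + j * stride N k‖ := by
        rcases e with rfl | rfl
        · rfl
        · rw [norm_neg]
      have hj' : (j : ℝ) ≤ M k := by exact_mod_cast hj.le
      have e3 : ‖c‖ ≤ ‖corner N M k‖ + M k * ‖stride N k‖ := by
        rw [e2]
        refine (norm_add_le _ _).trans ?_
        rw [norm_mul, Complex.norm_natCast]
        gcongr
      exact e3.trans (Finset.single_le_sum
        (f := fun k => ‖corner N M k‖ + M k * ‖stride N k‖)
        (fun i _ => by positivity) (mem_range.mpr hk))
    calc ‖z‖ = ‖c + (z - c)‖ := by rw [add_sub_cancel]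
      _ ≤ _ := (norm_add_le _ _).trans (add_le_add h1 (hcell _ hz))

theorem orbit_bounded (hN : 2 ≤ N) (h : Nat.Coprime a N) {z : ℂ}
    (hz : z ∉ criticalSet (rot N a)) :
    Bornology.IsBounded (Set.range fun n => (F (rot N a))^[n] z) := by
  obtain ⟨M, hM, hzM⟩ := exists_mem_polygon hN h z
  refine (necklaceRegion_bounded hN hM).subset ?_
  rintro _ ⟨n, rfl⟩
  induction n with
  | zero => exact Or.inl hzM
  | succ n ih =>
    simp only [Function.iterate_succ_apply']
    exact F_mem_necklaceRegion hN hM ih fun h0 => hz ⟨n, h0⟩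

end Geometry

section Dynamics

variable {lam : ℂ}

/-! ### Bijectivity, rigidity and periodicity on the regular set -/

/-- The inverse of `F`. -/
noncomputable def Finv (lam w : ℂ) : ℂ := lam⁻¹ * w + H (lam⁻¹ * w)

lemma H_add_H (w : ℂ) : H (w + H w) = H w ∧ H (w - H w) = H w := by
  have him : (H w).im = 0 := by unfold H; split_ifs <;> simp
  have key : ∀ x : ℂ, x.im = w.im → H x = H w := fun x hx => by simp only [H, hx]
  exact ⟨key _ (by simp [him]), key _ (by simp [him])⟩

lemma Finv_F (h0 : lam ≠ 0) (z : ℂ) : Finv lam (F lam z) = z := by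
  rw [Finv, F, inv_mul_cancel_left₀ h0, (H_add_H z).2, sub_add_cancel]

lemma F_Finv (h0 : lam ≠ 0) (w : ℂ) : F lam (Finv lam w) = w := by
  rw [Finv, F, (H_add_H _).1, add_sub_cancel_right, mul_inv_cancel_left₀ h0]

lemma F_injective (h0 : lam ≠ 0) : Function.Injective (F lam) :=
  Function.LeftInverse.injective (Finv_F h0)

lemma continuousAt_H {z : ℂ} (hz : z.im ≠ 0) : ContinuousAt H z := by
  rcases lt_or_gt_of_ne hz with h | h
  · have : H =ᶠ[nhds z] fun _ => -1 := by
      filter_upwards [Complex.continuous_im.isOpen_preimage _ isOpen_Iio |>.mem_nhds h] with w hw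
      exact H_of_neg hw
    exact (continuousAt_const).congr this.symm
  · have : H =ᶠ[nhds z] fun _ => 1 := by
      filter_upwards [Complex.continuous_im.isOpen_preimage _ isOpen_Ioi |>.mem_nhds h] with w hw
      exact H_of_pos (le_of_lt hw)
    exact (continuousAt_const).congr this.symm

lemma isOpen_regularSet : IsOpen (regularSet lam) := isClosed_closure.isOpen_compl

lemma notMem_criticalSet {z : ℂ} (hz : z ∈ regularSet lam) : z ∉ criticalSet lam :=
  fun h => hz (subset_closure h)

lemma im_ne_zero {z : ℂ} (hz : z ∈ regularSet lam) : z.im ≠ 0 :=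
  fun h => notMem_criticalSet hz ⟨0, h⟩

lemma exists_ball {z : ℂ} (hz : z ∈ regularSet lam) :
    ∃ r > 0, ∀ w ∈ Metric.ball z r, w ∉ criticalSet lam := by
  obtain ⟨r, hr, h⟩ := Metric.isOpen_iff.mp isOpen_regularSet z hz
  exact ⟨r, hr, fun w hw => notMem_criticalSet (h hw)⟩

lemma H_eq_of_segment {z w : ℂ} (h : ∀ u ∈ segment ℝ z w, u.im ≠ 0) : H z = H w := by
  have hconv := (convex_segment z w).isPreconnected.image _
    (Complex.continuous_im.continuousOn (s := segment ℝ z w))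
  have hz := Set.mem_image_of_mem Complex.im (left_mem_segment ℝ z w)
  have hw := Set.mem_image_of_mem Complex.im (right_mem_segment ℝ z w)
  have key : ∀ x ∈ Complex.im '' segment ℝ z w, x ≠ 0 := by
    rintro _ ⟨u, hu, rfl⟩; exact h u hu
  have hord := hconv.ordConnected
  unfold H
  rcases le_or_gt 0 z.im with h1 | h1 <;> rcases le_or_gt 0 w.im with h2 | h2
  · rw [if_pos h1, if_pos h2]
  · exact absurd rfl (key 0 (hord.out hw hz ⟨h2.le, h1⟩))
  · exact absurd rfl (key 0 (hord.out hz hw ⟨h1.le, h2⟩))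
  · rw [if_neg (not_le.mpr h1), if_neg (not_le.mpr h2)]

/-- By induction the image of a segment in the ball is a segment. It avoids the real line, so `H` is
constant on it and the next step is again rigid. -/
lemma iterate_sub {z : ℂ} {r : ℝ}
    (h : ∀ w ∈ Metric.ball z r, w ∉ criticalSet lam) (n : ℕ) :
    ∀ w ∈ Metric.ball z r, ∀ w' ∈ Metric.ball z r,
      (F lam)^[n] w' - (F lam)^[n] w = lam ^ n * (w' - w) := by
  induction n with
  | zero => intro w _ w' _; simp
  | succ n ih =>
    intro w hw w' hw'
    have hH : H ((F lam)^[n] w) = H ((F lam)^[n] w') := by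
      apply H_eq_of_segment
      intro u hu hu0
      rw [segment_eq_image'] at hu
      obtain ⟨t, ht, rfl⟩ := hu
      have hmem : w + t • (w' - w) ∈ Metric.ball z r := by
        apply (convex_ball z r).segment_subset hw hw'
        rw [segment_eq_image']
        exact ⟨t, ht, rfl⟩
      apply h _ hmem
      refine ⟨n, ?_⟩
      have e := ih w hw _ hmem
      have e' := ih w hw w' hw'
      rw [add_sub_cancel_left] at e
      have : (F lam)^[n] (w + t • (w' - w)) =
          (F lam)^[n] w + t • ((F lam)^[n] w' - (F lam)^[n] w) := by
        rw [e', ← mul_smul_comm, ← e]; ring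
      rw [this]; exact hu0
    rw [Function.iterate_succ_apply', Function.iterate_succ_apply', F, F, hH, pow_succ]
    linear_combination lam * ih w hw w' hw'

lemma F_mem_regularSet (h1 : ‖lam‖ = 1) {z : ℂ} (hz : z ∈ regularSet lam) :
    F lam z ∈ regularSet lam := by
  have h0 : lam ≠ 0 := by rintro rfl; simp at h1
  obtain ⟨r, hr, h⟩ := exists_ball hz
  have hsub : Metric.ball (F lam z) r ⊆ (criticalSet lam)ᶜ := by
    intro y hy
    have hw : z + lam⁻¹ * (y - F lam z) ∈ Metric.ball z r := by
      rw [mem_ball_iff_norm] at hy ⊢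
      rw [add_sub_cancel_left, norm_mul, norm_inv, h1, inv_one, one_mul]
      exact hy
    have e := iterate_sub h 1 z (Metric.mem_ball_self hr) _ hw
    simp only [Function.iterate_one, pow_one, add_sub_cancel_left,
      mul_inv_cancel_left₀ h0, sub_left_inj] at e
    rintro ⟨i, hi⟩
    refine h _ hw ⟨i + 1, ?_⟩
    rw [Function.iterate_succ_apply, e]; exact hi
  have := interior_maximal hsub Metric.isOpen_ball (Metric.mem_ball_self hr)
  rwa [interior_compl] at this

lemma exists_periodic (h1 : ‖lam‖ = 1) {q : ℕ} (hq : 0 < q) (hlam : lam ^ q = 1) {z : ℂ}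
    (hz : z ∈ regularSet lam)
    (hb : Bornology.IsBounded (Set.range fun n => (F lam)^[n] z)) :
    ∃ n, 0 < n ∧ (F lam)^[n] z = z := by
  have h0 : lam ≠ 0 := by rintro rfl; simp at h1
  obtain ⟨r, hr, h⟩ := exists_ball hz
  have hzb := Metric.mem_ball_self (x := z) hr
  obtain ⟨n, k, hk, hd⟩ : ∃ n k : ℕ, 0 < k ∧
      ‖(F lam)^[q * (n + k)] z - (F lam)^[q * n] z‖ < r := by
    obtain ⟨a, -, φ, hφ, ha⟩ := tendsto_subseq_of_bounded hb
      (x := fun n => (F lam)^[q * n] z) (fun n => ⟨q * n, rfl⟩)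
    obtain ⟨K, hK⟩ := Metric.cauchySeq_iff'.mp ha.cauchySeq r hr
    have hlt : φ K < φ (K + 1) := hφ (Nat.lt_succ_self K)
    refine ⟨φ K, φ (K + 1) - φ K, by omega, ?_⟩
    have := hK (K + 1) (by omega)
    rw [dist_eq_norm] at this
    rwa [Nat.add_sub_cancel' hlt.le]
  set p := q * k with hp
  have hp0 : 0 < p := Nat.mul_pos hq hk
  have hpow : ∀ j, lam ^ (q * j) = 1 := fun j => by rw [pow_mul, hlam, one_pow]
  set v := (F lam)^[p] z - z with hv
  have hvb : z + v ∈ Metric.ball z r := by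
    set u := (F lam)^[q * (n + k)] z - (F lam)^[q * n] z with hu
    have hub : z + u ∈ Metric.ball z r := by
      rw [mem_ball_iff_norm, add_sub_cancel_left]; exact hd
    have e := iterate_sub h (q * n) z hzb _ hub
    rw [hpow, one_mul, add_sub_cancel_left, hu, sub_left_inj, ← hu, mul_add,
      Function.iterate_add_apply] at e
    -- Cancelling the first `q * n` steps turns the near return between two late times into a near
    -- return to `z` itself.
    have := (F_injective h0).iterate (q * n) e
    rw [hv, add_sub_cancel, ← this]
    exact hub
  have hiter : ∀ j : ℕ, (F lam)^[p * j] z = z + j * v := by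
    intro j
    induction j with
    | zero => simp
    | succ j ih =>
      -- Only `z` and `z + v` need lie in the ball: the translation by `v` is carried along the
      -- orbit by rigidity, even after the orbit has left the ball.
      have e := iterate_sub h (p * j) z hzb _ hvb
      rw [hp, mul_assoc, hpow, ← mul_assoc, ← hp, one_mul, add_sub_cancel_left, ih] at e
      rw [mul_add, mul_one, Function.iterate_add_apply,
        show (F lam)^[p] z = z + v by rw [hv]; ring]
      push_cast
      linear_combination e
  refine ⟨p, hp0, ?_⟩
  by_contra hne
  have hv0 : 0 < ‖v‖ := norm_pos_iff.mpr (sub_ne_zero.mpr hne)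
  obtain ⟨C, hC⟩ := isBounded_iff_forall_norm_le.mp hb
  obtain ⟨j, hj⟩ := exists_nat_gt ((C + ‖z‖) / ‖v‖)
  have h2 := hC _ ⟨p * j, rfl⟩
  simp only [hiter] at h2
  rw [div_lt_iff₀ hv0] at hj
  have h3 : ‖(j : ℂ) * v‖ ≤ ‖z + j * v‖ + ‖z‖ := by
    have := norm_sub_le (z + j * v) z
    rwa [add_sub_cancel_left] at this
  rw [norm_mul, Complex.norm_natCast] at h3
  linarith

lemma continuousOn_F : ContinuousOn (F lam) (regularSet lam) := fun _ hz =>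
  (continuousAt_const.mul (continuousAt_id.sub
    (continuousAt_H (im_ne_zero hz)))).continuousWithinAt

/-- If `F z` is regular, its periodic orbit consists of regular points and, by injectivity, contains
`z`. -/
lemma F_preimage_regularSet (h1 : ‖lam‖ = 1)
    (hper : ∀ z ∈ regularSet lam, ∃ n : ℕ, 0 < n ∧ (F lam)^[n] z = z) :
    F lam ⁻¹' regularSet lam = regularSet lam := by
  have h0 : lam ≠ 0 := by rintro rfl; simp at h1
  have hiter : ∀ n, ∀ z ∈ regularSet lam, (F lam)^[n] z ∈ regularSet lam := by
    intro n z hz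
    induction n with
    | zero => exact hz
    | succ n ih => rw [Function.iterate_succ_apply']; exact F_mem_regularSet h1 ih
  refine Set.Subset.antisymm (fun z hz => ?_) fun _ hz => F_mem_regularSet h1 hz
  obtain ⟨n, hn, e⟩ := hper _ hz
  obtain ⟨m, rfl⟩ : ∃ m, n = m + 1 := ⟨n - 1, by omega⟩
  rw [Function.iterate_succ_apply'] at e
  have := hiter m _ hz
  rwa [F_injective h0 e] at this

lemma continuousOn_Finv (h0 : lam ≠ 0)
    (hpre : F lam ⁻¹' regularSet lam = regularSet lam) :
    ContinuousOn (Finv lam) (regularSet lam) := by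
  intro w hw
  have hz : Finv lam w ∈ regularSet lam := by
    rw [← hpre, Set.mem_preimage, F_Finv h0]; exact hw
  have him : (lam⁻¹ * w).im ≠ 0 := by
    have := im_ne_zero hz
    have e : (H (lam⁻¹ * w)).im = 0 := by unfold H; split_ifs <;> simp
    rwa [Finv, Complex.add_im, e, add_zero] at this
  have hmul : ContinuousAt (fun w : ℂ => lam⁻¹ * w) w := continuousAt_const.mul continuousAt_id
  exact (hmul.add (ContinuousAt.comp (f := fun w : ℂ => lam⁻¹ * w)
    (continuousAt_H him) hmul)).continuousWithinAt

lemma image_component (h0 : lam ≠ 0)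
    (hpre : F lam ⁻¹' regularSet lam = regularSet lam) {z : ℂ} (hz : z ∈ regularSet lam) :
    F lam '' connectedComponentIn (regularSet lam) z =
      connectedComponentIn (regularSet lam) (F lam z) := by
  have hFz : F lam z ∈ regularSet lam := by rw [← hpre] at hz; exact hz
  have hsub := connectedComponentIn_subset (regularSet lam)
  apply Set.Subset.antisymm
  · apply IsPreconnected.subset_connectedComponentIn
    · exact isPreconnected_connectedComponentIn.image _ (continuousOn_F.mono (hsub z))
    · exact ⟨z, mem_connectedComponentIn hz, rfl⟩
    · rintro _ ⟨w, hw, rfl⟩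
      have := hsub z hw
      rw [← hpre] at this; exact this
  · intro w hw
    refine ⟨Finv lam w, ?_, F_Finv h0 w⟩
    have : Finv lam '' connectedComponentIn (regularSet lam) (F lam z) ⊆
        connectedComponentIn (regularSet lam) z := by
      apply IsPreconnected.subset_connectedComponentIn
      · exact isPreconnected_connectedComponentIn.image _
          ((continuousOn_Finv h0 hpre).mono (hsub _))
      · exact ⟨F lam z, mem_connectedComponentIn hFz, Finv_F h0 z⟩
      · rintro _ ⟨y, hy, rfl⟩
        rw [← hpre, Set.mem_preimage, F_Finv h0]
        exact hsub _ hy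
    exact this ⟨w, hw, rfl⟩

/-- For even `q` take `N = q / 2` and `a = p`; for odd `q` take `N = q` and `a = 2 * p`. The bound
`3 ≤ q` ensures `2 ≤ N`. -/
lemma exists_rot (p q : ℕ) (hq : 3 ≤ q) (hpq : Nat.Coprime p q) :
    ∃ N a, 2 ≤ N ∧ Nat.Coprime a N ∧
      Complex.exp ((2 * Real.pi * p / q : ℝ) * Complex.I) = rot N a := by
  have key : ∀ N a : ℕ, (2 * Real.pi * p / q : ℝ) = a * angle N →
      Complex.exp ((2 * Real.pi * p / q : ℝ) * Complex.I) = rot N a := by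
    intro N a e
    rw [e]
    apply Complex.ext
    · rw [Complex.exp_ofReal_mul_I_re]; rfl
    · rw [Complex.exp_ofReal_mul_I_im]; rfl
  have hq0 : (q : ℝ) ≠ 0 := by positivity
  rcases Nat.even_or_odd' q with ⟨m, rfl | rfl⟩
  · refine ⟨m, p, by omega, Nat.Coprime.coprime_mul_left_right hpq, key _ _ ?_⟩
    have : (m : ℝ) ≠ 0 := by rintro h; simp [h] at hq0
    unfold angle; push_cast; field_simp
  · refine ⟨2 * m + 1, 2 * p, by omega, Nat.Coprime.mul_left (by simp) hpq, key _ _ ?_⟩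
    unfold angle; push_cast; push_cast at hq0; field_simp

end Dynamics

end PiecewiseRotation

theorem mainTheorem6 (p q : ℕ) (hq : 3 ≤ q) (hpq : Nat.Coprime p q) (lam : ℂ)
    (hlam : lam = Complex.exp ((2 * Real.pi * p / q : ℝ) * Complex.I)) :
    (PiecewiseRotation.F lam '' PiecewiseRotation.regularSet lam
        = PiecewiseRotation.regularSet lam ∧
      PiecewiseRotation.F lam ⁻¹' PiecewiseRotation.regularSet lam
        = PiecewiseRotation.regularSet lam) ∧
    (PiecewiseRotation.F lam '' closure (PiecewiseRotation.criticalSet lam)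
        = closure (PiecewiseRotation.criticalSet lam) ∧
      PiecewiseRotation.F lam ⁻¹' closure (PiecewiseRotation.criticalSet lam)
        = closure (PiecewiseRotation.criticalSet lam)) ∧
    (∃ e : PiecewiseRotation.regularSet lam ≃ₜ PiecewiseRotation.regularSet lam,
      ∀ z : PiecewiseRotation.regularSet lam, (e z : ℂ) = PiecewiseRotation.F lam z) ∧
    (∀ z ∈ PiecewiseRotation.regularSet lam,
      ∃ n : ℕ, 0 < n ∧ (PiecewiseRotation.F lam)^[n] z = z) ∧
    Set.BijOn (fun V : Set ℂ => PiecewiseRotation.F lam '' V)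
      (PiecewiseRotation.components (PiecewiseRotation.regularSet lam))
      (PiecewiseRotation.components (PiecewiseRotation.regularSet lam)) := by
  open PiecewiseRotation in
  have h1 : ‖lam‖ = 1 := by rw [hlam]; exact Complex.norm_exp_ofReal_mul_I _
  have h0 : lam ≠ 0 := by rintro rfl; simp at h1
  have hpow : lam ^ q = 1 := by
    have hq0 : (q : ℂ) ≠ 0 := by exact_mod_cast (by omega : q ≠ 0)
    rw [hlam, ← Complex.exp_nat_mul, Complex.exp_eq_one_iff]
    refine ⟨p, ?_⟩
    push_cast; field_simp
  have hper : ∀ z ∈ regularSet lam, ∃ n : ℕ, 0 < n ∧ (F lam)^[n] z = z := by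
    intro z hz
    refine exists_periodic h1 (by omega) hpow hz ?_
    obtain ⟨N, a, hN, ha, e⟩ := exists_rot p q hq hpq
    have hz' := notMem_criticalSet hz
    rw [hlam, e] at hz' ⊢
    exact orbit_bounded hN ha hz'
  have hpre := F_preimage_regularSet h1 hper
  have hsurj : Function.Surjective (F lam) := fun w => ⟨_, F_Finv h0 w⟩
  have hcl : (regularSet lam)ᶜ = closure (criticalSet lam) := compl_compl _
  have hpre' : F lam ⁻¹' closure (criticalSet lam) = closure (criticalSet lam) := by
    rw [← hcl, Set.preimage_compl, hpre]
  have hmem : ∀ z, F lam z ∈ regularSet lam ↔ z ∈ regularSet lam := fun z => by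
    conv_rhs => rw [← hpre]
    rfl
  have hinv : ∀ w ∈ regularSet lam, Finv lam w ∈ regularSet lam := fun w hw => by
    rw [← hmem, F_Finv h0]; exact hw
  refine ⟨⟨?_, hpre⟩, ⟨?_, hpre'⟩, ?_, hper, ?_, ?_, ?_⟩
  · conv_lhs => rw [← hpre]
    exact Set.image_preimage_eq _ hsurj
  · conv_lhs => rw [← hpre']
    exact Set.image_preimage_eq _ hsurj
  · refine ⟨{
      toFun := fun z => ⟨F lam z, (hmem z).mpr z.2⟩
      invFun := fun w => ⟨Finv lam w, hinv w w.2⟩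
      left_inv := fun z => Subtype.ext (Finv_F h0 z)
      right_inv := fun w => Subtype.ext (F_Finv h0 w)
      continuous_toFun := (continuousOn_iff_continuous_domRestrict.mp continuousOn_F).subtype_mk _
      continuous_invFun := (continuousOn_iff_continuous_domRestrict.mp
        (continuousOn_Finv h0 hpre)).subtype_mk _ }, fun z => rfl⟩
  · rintro _ ⟨z, hz, rfl⟩
    exact ⟨F lam z, (hmem z).mpr hz, image_component h0 hpre hz⟩
  · exact (Set.image_injective.mpr (F_injective h0)).injOn
  · rintro _ ⟨w, hw, rfl⟩
    refine ⟨_, ⟨Finv lam w, hinv w hw, rfl⟩, ?_⟩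
    simp only
    rw [image_component h0 hpre (hinv w hw), F_Finv h0]
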